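/- Let $(X,d)$ be a metric space with integer-valued metric. A split of $X$ is an unordered pair $S=\{A,B\}$ of non-empty disjoint subsets with $A\cup B=X$; put $\delta_S(x,y)=0$ if $x,y$ lie in the same part of $S$ and $\delta_S(x,y)=1$ otherwise, and $$\alpha_S=\tfrac12\inf_{a,a'\in A,\ b,b'\in B}\bigl[\max\{d(a,b)+d(a',b'),\,d(a',b)+d(a,b'),\,d(a,a')+d(b,b')\}-d(a,a')-d(b,b')\bigr].$$ The $d$-splits are the splits with $\alpha_S>0$. Let $$\mathrm E(X,d)=\{f\in\mathbb R^X: f(x)=\sup_{y\in X}(d(x,y)-f(y))\ \text{for all } x\in X\}$$ be the injective hull of $(X,d)$. For $f\in\mathbb R^X$ let $A(f)$ be the set of unordered pairs $\{x,y\}$ (with $x=y$ allowed) such that $f(x)+f(y)=d(x,y)$, and let $\mathrm E'(X,d)$ be the set of all $f\in\mathbb R^X$ such that $f(x)+f(y)\ge d(x,y)$ for all $x,y\in X$ and every point of $X$ belongs to some pair in $A(f)$. For $f\in \mathrm E'(X,d)$ let $H(A(f))=\{g\in\mathbb R^X: A(f)\subset A(g)\}$, an affine subspace of $\mathbb R^X$.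 The cells of $\mathrm E(X,d)$ are the sets $\mathrm E(X,d)\cap H(A(f))$ with $f\in\mathrm E'(X,d)$. Assume that 1. $(X,d)$ is totally split-decomposable: $d=\sum_S\alpha_S\delta_S$, the sum being over all $d$-splits $S$ of $X$; 2. $(X,d)$ satisfies the local rank condition: for every $f\in\mathrm E(X,d)$ there are $\varepsilon>0$ and $N\in\mathbb N$ such that $\dim H(A(g))\le N$ for all $g\in\mathrm E'(X,d)$ with $\|f-g\|_\infty<\varepsilon$; 3. every cell of $\mathrm E(X,d)$ is a combinatorial hypercube, i.e. a convex polytope whose face lattice is isomorphic to the face lattice of a cube $[0,1]^n$ for some $n\ge 0$. Then $\mathrm E(X,d)$ satisfies the CAT(0) link condition: for every integer $k\ge0$ and all cells $C$, $C_1^1,C_1^2,C_1^3$, $C_2^1,C_2^2,C_2^3$ of $\mathrm E(X,d)$ such that $$C=C_2^1\cap C_2^2\cap C_2^3,\qquad C_1^j=\bigcap_{i\in\{1,2,3\}\setminus\{j\}}C_2^i\quad(j=1,2,3),$$ and $\dim C=k$, $\dim C_1^i=k+1$, $\dim C_2^i=k+2$ for $i=1,2,3$, there is a cell $\bar C$ of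 $\mathrm E(X,d)$ with $\dim\bar C=k+3$ and $C_2^1\cup C_2^2\cup C_2^3\subset\bar C$. -/

import Mathlib

namespace InjHull

/-! ### Splits and isolation indices -/

/-- A split `{A, B}` of `X`: an unordered pair of non-empty disjoint subsets with union `X`. -/
def Split (X : Type*) : Type _ :=
  {S : Sym2 (Set X) // ∃ A B : Set X,
    S = s(A, B) ∧ A.Nonempty ∧ B.Nonempty ∧ Disjoint A B ∧ A ∪ B = Set.univ}

open Classical in
/-- The split pseudometric `δ_S`: it vanishes at `(x, y)` if `x` and `y` lie in the same part of
`S`, and equals `1` otherwise. -/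
noncomputable def Split.delta {X : Type*} (S : Split X) (x y : X) : ℝ :=
  if ∃ A ∈ S.1, x ∈ A ∧ y ∈ A then 0 else 1

/-- The isolation index of a pair of subsets. The infimum is over a set of non-negative reals,
which is non-empty as soon as `A` and `B` are. -/
noncomputable def isolationIndex {X : Type*} [PseudoMetricSpace X] (A B : Set X) : ℝ :=
  (1 / 2) * sInf {r : ℝ | ∃ a ∈ A, ∃ a' ∈ A, ∃ b ∈ B, ∃ b' ∈ B,
    r = max (dist a b + dist a' b') (max (dist a' b + dist a b') (dist a a' + dist b b'))
      - dist a a' - dist b b'}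

theorem isolationIndex_comm {X : Type*} [PseudoMetricSpace X] (A B : Set X) :
    isolationIndex A B = isolationIndex B A := by
  have key : ∀ A B : Set X, ∀ r : ℝ,
      (∃ a ∈ A, ∃ a' ∈ A, ∃ b ∈ B, ∃ b' ∈ B,
        r = max (dist a b + dist a' b') (max (dist a' b + dist a b') (dist a a' + dist b b'))
          - dist a a' - dist b b') →
      ∃ a ∈ B, ∃ a' ∈ B, ∃ b ∈ A, ∃ b' ∈ A,
        r = max (dist a b + dist a' b') (max (dist a' b + dist a b') (dist a a' + dist b b'))
          - dist a a' - dist b b' := by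
    rintro A B r ⟨a, ha, a', ha', b, hb, b', hb', rfl⟩
    refine ⟨b, hb, b', hb', a, ha, a', ha', ?_⟩
    rw [dist_comm b a, dist_comm b' a', dist_comm b' a, dist_comm b a',
      add_comm (dist b b') (dist a a'), add_comm (dist a b') (dist a' b)]
    ring
  unfold isolationIndex
  congr 2
  ext r
  exact ⟨key A B r, key B A r⟩

/-- The isolation index `α_S` of a split. -/
noncomputable def Split.alpha {X : Type*} [PseudoMetricSpace X] (S : Split X) : ℝ :=
  Sym2.lift ⟨isolationIndex, isolationIndex_comm⟩ S.1

/-- The `d`-splits: the splits of positive isolation index. -/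
def dSplits (X : Type*) [PseudoMetricSpace X] : Set (Split X) := {S | 0 < S.alpha}

/-- `d = ∑ α_S δ_S`, the sum being over all `d`-splits. -/
def TotallySplitDecomposable (X : Type*) [PseudoMetricSpace X] : Prop :=
  ∀ x y : X, HasSum (fun S : dSplits X => S.1.alpha * S.1.delta x y) (dist x y)

def IntegerValued (X : Type*) [PseudoMetricSpace X] : Prop :=
  ∀ x y : X, ∃ n : ℤ, dist x y = n

/-! ### The injective hull and its cells -/

/-- Isbell's injective hull `E(X, d)`: the functions `f` with
`f x = sup_y (d(x, y) - f y)` for all `x`. -/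
def hull (X : Type*) [PseudoMetricSpace X] : Set (X → ℝ) :=
  {f | ∀ x, IsLUB (Set.range fun y => dist x y - f y) (f x)}

def Delta (X : Type*) [PseudoMetricSpace X] : Set (X → ℝ) :=
  {f | ∀ x y, dist x y ≤ f x + f y}

/-- The edge set `A(f)`; loops are allowed. -/
def edges {X : Type*} [PseudoMetricSpace X] (f : X → ℝ) : Set (Sym2 X) :=
  {e | ∃ x y, e = s(x, y) ∧ f x + f y = dist x y}

/-- `E'(X, d)`: the `f ∈ Δ(X, d)` such that the edges of `A(f)` cover `X`. -/
def hull' (X : Type*) [PseudoMetricSpace X] : Set (X → ℝ) :=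
  {f | f ∈ Delta X ∧ ∀ x, ∃ e ∈ edges f, x ∈ e}

/-- The affine subspace `H(A) = {g | A ⊆ A(g)}`. -/
def affH {X : Type*} [PseudoMetricSpace X] (A : Set (Sym2 X)) : AffineSubspace ℝ (X → ℝ) where
  carrier := {g | ∀ x y, s(x, y) ∈ A → g x + g y = dist x y}
  smul_vsub_vadd_mem' := by
    intro c p q r hp hq hr x y hxy
    have h1 := hp x y hxy
    have h2 := hq x y hxy
    have h3 := hr x y hxy
    simp only [vsub_eq_sub, vadd_eq_add, Pi.add_apply, Pi.smul_apply, Pi.sub_apply, smul_eq_mul]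
    linear_combination c * h1 - c * h2 + h3

/-- `rank A = dim H(A)`, possibly infinite. -/
noncomputable def rk {X : Type*} [PseudoMetricSpace X] (A : Set (Sym2 X)) : Cardinal :=
  Module.rank ℝ (affH A).direction

/-- The local rank condition; `∃ r < ε, ∀ x, |f x - g x| ≤ r` says `‖f - g‖_∞ < ε`.
It holds automatically if `X` is finite. -/
def LocalRankCondition (X : Type*) [PseudoMetricSpace X] : Prop :=
  ∀ f ∈ hull X, ∃ ε > (0 : ℝ), ∃ N : ℕ, ∀ g ∈ hull' X,
    (∃ r < ε, ∀ x, |f x - g x| ≤ r) → rk (edges g) ≤ N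

/-- The cells of `E(X, d)`: the sets `P(A) = E(X, d) ∩ H(A)` for `A` admissible, that is
`A = A(f)` for some `f ∈ E'(X, d)`. -/
def cells (X : Type*) [PseudoMetricSpace X] : Set (Set (X → ℝ)) :=
  {C | ∃ f ∈ hull' X, C = hull X ∩ (affH (edges f) : Set (X → ℝ))}

/-! ### Combinatorial hypercubes and the link condition -/

/-- The faces of a convex set, the empty face and the set itself included; ordered by inclusion. -/
abbrev Faces {V : Type*} [AddCommGroup V] [Module ℝ V] (C : Set V) : Type _ :=
  {F : Set V // Convex ℝ F ∧ IsExtreme ℝ C F}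

/-- A convex polytope whose face lattice is isomorphic to the one of a cube `[0, 1]^n`. -/
def IsCombinatorialHypercube {V : Type*} [AddCommGroup V] [Module ℝ V] (C : Set V) : Prop :=
  (∃ s : Finset V, C = convexHull ℝ (s : Set V)) ∧
    ∃ n : ℕ, Nonempty (Faces C ≃o Faces (Set.Icc (0 : Fin n → ℝ) 1))

/-- The dimension of a convex set: the dimension of its affine hull. -/
noncomputable def cellDim {V : Type*} [AddCommGroup V] [Module ℝ V] (C : Set V) : Cardinal :=
  Module.rank ℝ (vectorSpan ℝ C)

/-- The CAT(0) link condition, for a complex given by its set of cells. -/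
def CAT0LinkCondition {V : Type*} [AddCommGroup V] [Module ℝ V] (K : Set (Set V)) : Prop :=
  ∀ (k : ℕ) (C : Set V) (C₁ C₂ : Fin 3 → Set V),
    C ∈ K → (∀ i, C₁ i ∈ K) → (∀ i, C₂ i ∈ K) →
    C = ⋂ i, C₂ i →
    (∀ j, C₁ j = ⋂ i, ⋂ (_ : i ≠ j), C₂ i) →
    cellDim C = k →
    (∀ i, cellDim (C₁ i) = (k + 1 : ℕ)) →
    (∀ i, cellDim (C₂ i) = (k + 2 : ℕ)) →
    ∃ D ∈ K, cellDim D = (k + 3 : ℕ) ∧ (⋃ i, C₂ i) ⊆ D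

end InjHull

/-!
Every cell is determined by the edge graph `A(f)` of any of its relative interior points `f`, with
more edges for smaller cells. Let `f 0, f 1, f 2` be interior points of the three `(k + 2)`-cells
and `e 0, e 1, e 2` interior points of their pairwise intersections. The strict quartet inequalities
satisfied by `d`-splits, together with their weak compatibility, imply that the neighbourhoods of a
vertex in three edge graphs have a common point as soon as they meet pairwise. Hence the common
edges of the `e j` still cover `X`, and a point `h` inside the triangle of the `e j` spans a cell
containing the cells of all `f i`.

That the dimension of this cell is at most `k + 3` follows from the combinatorics of a cube, where
three faces of dimension `k + 1` through a common `k`-face lie in a face of dimension at most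
`k + 3`. This face contains `h`, so it must be the whole cell because `h` is a relative interior
point. The latter is clear for finite `X`. In general it requires the slacks `h x + h y - d(x, y)`
to be bounded away from `0` off the edges. Here integrality enters: for every odd `1`-periodic
Lipschitz function `φ`, the function `φ ∘ h` is parallel to the cell of `h`, so the finite dimension
of the cell forces `h` to take finitely many values modulo `1` up to sign.
-/

namespace InjHull

/-! ### Convex polytopes and their facets -/

section Convex

open Module

variable {V : Type*} [AddCommGroup V] [Module ℝ V]

theorem mem_of_isExtreme_of_add_smul_sub_mem {P F : Set V} (hF : IsExtreme ℝ P F) {p x : V}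
    (hp : p ∈ F) (hx : x ∈ P) {t : ℝ} (ht : 0 < t) (h : p + t • (p - x) ∈ P) : x ∈ F := by
  refine hF.left_mem_of_mem_openSegment hx h hp
    ⟨t / (1 + t), 1 / (1 + t), by positivity, by positivity, by field_simp; ring, ?_⟩
  match_scalars
  · field_simp
    ring
  · field_simp

theorem vectorSpan_convexHull (s : Set V) : vectorSpan ℝ (convexHull ℝ s) = vectorSpan ℝ s := by
  rw [← direction_affineSpan, affineSpan_convexHull, direction_affineSpan]

theorem exists_smul_sub_of_mem_vectorSpan {C : Set V} (hC : Convex ℝ C) (hne : C.Nonempty) {v : V}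
    (hv : v ∈ vectorSpan ℝ C) : ∃ a ∈ C, ∃ b ∈ C, ∃ t > (0 : ℝ), v = t • (a - b) := by
  obtain ⟨c, hc⟩ := hne
  rw [vectorSpan_def] at hv
  induction hv using Submodule.span_induction with
  | mem v hv =>
    obtain ⟨a, ha, b, hb, rfl⟩ := hv
    exact ⟨a, ha, b, hb, 1, one_pos, (one_smul ℝ _).symm⟩
  | zero => exact ⟨c, hc, c, hc, 1, one_pos, by simp⟩
  | add v w _ _ hv hw =>
    obtain ⟨a, ha, b, hb, t, ht, rfl⟩ := hv
    obtain ⟨a', ha', b', hb', t', ht', rfl⟩ := hw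
    have hsum : t / (t + t') + t' / (t + t') = 1 := by field_simp
    refine ⟨_, hC ha ha' (by positivity) (by positivity) hsum, _,
      hC hb hb' (by positivity) (by positivity) hsum, t + t', by positivity, ?_⟩
    match_scalars <;> field_simp
  | smul r v _ hv =>
    obtain ⟨a, ha, b, hb, t, ht, rfl⟩ := hv
    rcases lt_trichotomy r 0 with hr | rfl | hr
    · exact ⟨b, hb, a, ha, -r * t, by nlinarith, by module⟩
    · exact ⟨c, hc, c, hc, 1, one_pos, by simp⟩
    · exact ⟨a, ha, b, hb, r * t, by positivity, by module⟩

theorem mem_of_isExtreme_of_sub_mem_vectorSpan {P F : Set V} (hF : Convex ℝ F)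
    (hPF : IsExtreme ℝ P F) {p x : V} (hp : p ∈ F) (hx : x ∈ P) (h : x - p ∈ vectorSpan ℝ F) :
    x ∈ F := by
  obtain ⟨a, ha, b, hb, t, ht, hab⟩ := exists_smul_sub_of_mem_vectorSpan hF ⟨p, hp⟩ h
  have hq : (1 / (1 + t)) • p + (t / (1 + t)) • a ∈ F :=
    hF hp ha (by positivity) (by positivity) (by field_simp)
  refine mem_of_isExtreme_of_add_smul_sub_mem hPF hq hx (t := t⁻¹) (by positivity) ?_
  convert hPF.subset hb using 1
  rw [eq_add_of_sub_eq hab]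
  match_scalars <;> field_simp <;> ring

theorem finrank_vectorSpan_lt_of_isExtreme {P F : Set V} [FiniteDimensional ℝ (vectorSpan ℝ P)]
    (hF : Convex ℝ F) (hPF : IsExtreme ℝ P F) (hne : F.Nonempty) (hFP : F ≠ P) :
    finrank ℝ (vectorSpan ℝ F) < finrank ℝ (vectorSpan ℝ P) := by
  refine Submodule.finrank_lt_finrank_of_lt ((vectorSpan_mono ℝ hPF.subset).lt_of_ne fun heq => ?_)
  obtain ⟨p, hp⟩ := hne
  exact hFP (hPF.subset.antisymm fun x hx => mem_of_isExtreme_of_sub_mem_vectorSpan hF hPF hp hx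
    (heq ▸ vsub_mem_vectorSpan ℝ hx (hPF.subset hp)))

theorem eq_convexHull_inter_of_isExtreme {s F : Set V} (hF : Convex ℝ F)
    (hsF : IsExtreme ℝ (convexHull ℝ s) F) : F = convexHull ℝ (s ∩ F) := by
  refine subset_antisymm (fun x hx => ?_) (convexHull_min Set.inter_subset_right hF)
  have hK : Convex ℝ {x ∈ convexHull ℝ s | x ∈ F → x ∈ convexHull ℝ (s ∩ F)} := by
    refine convex_iff_openSegment_subset.2 fun y hy z hz w hw =>
      ⟨(convex_convexHull ℝ s).openSegment_subset hy.1 hz.1 hw, fun hwF => ?_⟩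
    exact (convex_convexHull ℝ _).openSegment_subset
      (hy.2 (hsF.left_mem_of_mem_openSegment hy.1 hz.1 hwF hw))
      (hz.2 (hsF.right_mem_of_mem_openSegment hy.1 hz.1 hwF hw)) hw
  have hsK : s ⊆ {x ∈ convexHull ℝ s | x ∈ F → x ∈ convexHull ℝ (s ∩ F)} := fun x hx =>
    ⟨subset_convexHull ℝ s hx, fun hxF => subset_convexHull ℝ _ ⟨hx, hxF⟩⟩
  exact (convexHull_min hsK hK (hsF.subset hx)).2 hx

/-- A convex polytope, in the sense of `IsCombinatorialHypercube`. -/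
def IsPolytope (P : Set V) : Prop := ∃ s : Finset V, P = convexHull ℝ (s : Set V)

theorem isPolytope_convexHull_of_finite {s : Set V} (hs : s.Finite) :
    IsPolytope (convexHull ℝ s) := ⟨hs.toFinset, by rw [hs.coe_toFinset]⟩

theorem IsPolytope.finiteDimensional {P : Set V} (hP : IsPolytope P) :
    FiniteDimensional ℝ (vectorSpan ℝ P) := by
  obtain ⟨s, rfl⟩ := hP
  rw [vectorSpan_convexHull]
  exact finiteDimensional_vectorSpan_of_finite ℝ s.finite_toSet

theorem IsPolytope.of_isExtreme {P F : Set V} (hP : IsPolytope P) (hF : Convex ℝ F)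
    (hPF : IsExtreme ℝ P F) : IsPolytope F := by
  obtain ⟨s, rfl⟩ := hP
  rw [eq_convexHull_inter_of_isExtreme hF hPF]
  exact isPolytope_convexHull_of_finite (s.finite_toSet.inter_of_left F)

theorem cellDim_eq_natCast_iff {P : Set V} [FiniteDimensional ℝ (vectorSpan ℝ P)] {k : ℕ} :
    cellDim P = k ↔ finrank ℝ (vectorSpan ℝ P) = k := by
  rw [cellDim, ← finrank_eq_rank, Nat.cast_inj]

/-- `t` is a proper non-empty exposed face of the point configuration `s`: the set of maximisers
on `s` of a linear functional that is not constant on `s`. -/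
def IsExposedFace (s t : Set V) : Prop :=
  t.Nonempty ∧ t ≠ s ∧ ∃ (φ : Dual ℝ V) (c : ℝ), (∀ x ∈ s, φ x ≤ c) ∧ t = {x ∈ s | φ x = c}

theorem IsExposedFace.subset {s t : Set V} (h : IsExposedFace s t) : t ⊆ s := by
  obtain ⟨-, -, φ, c, -, rfl⟩ := h
  exact Set.sep_subset _ _

theorem exists_isExposedFace {s : Set V} (hfin : s.Finite) (hs : s.Nontrivial) :
    ∃ t, IsExposedFace s t := by
  obtain ⟨a, ha, b, hb, hab⟩ := hs
  obtain ⟨φ, hφ⟩ : ∃ φ : Dual ℝ V, φ (a - b) ≠ 0 := by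
    by_contra! h
    exact hab (sub_eq_zero.1 ((forall_dual_apply_eq_zero_iff ℝ _).1 h))
  obtain ⟨q, hq, hmax⟩ := Set.exists_max_image s φ hfin ⟨a, ha⟩
  refine ⟨{x ∈ s | φ x = φ q}, ⟨q, hq, rfl⟩, fun h => hφ ?_, φ, φ q, hmax, rfl⟩
  rw [Set.sep_eq_self_iff_mem_true] at h
  rw [map_sub, h a ha, h b hb, sub_self]

theorem exists_dual_of_finrank_add_one_lt {L M : Submodule ℝ V} [FiniteDimensional ℝ L]
    [FiniteDimensional ℝ M] (h : finrank ℝ L + 1 < finrank ℝ M) (φ : Dual ℝ V) :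
    ∃ u ∈ M, φ u = 0 ∧ ∃ l : Dual ℝ V, l u ≠ 0 ∧ L ≤ l.ker := by
  obtain ⟨u, huM, hu, huL⟩ : ∃ u ∈ M, φ u = 0 ∧ u ∉ L := by
    by_contra! hcon
    have hker : finrank ℝ (φ.domRestrict M).ker ≤ finrank ℝ L := by
      rw [← Submodule.finrank_map_subtype_eq]
      refine Submodule.finrank_mono ?_
      rintro _ ⟨x, hx, rfl⟩
      exact hcon x x.2 hx
    have hrange : finrank ℝ (φ.domRestrict M).range ≤ 1 :=
      (Submodule.finrank_le _).trans_eq (finrank_self ℝ)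
    have := (φ.domRestrict M).finrank_range_add_finrank_ker
    omega
  exact ⟨u, huM, hu, Submodule.exists_le_ker_of_notMem huL⟩

/-- `t` is the largest value for which `φ + t • l` is still at most `c + t * d` on `s`. -/
theorem exists_add_mul_le_of_maximisers {α : Type*} {s : Set α} (hfin : s.Finite) {φ l : α → ℝ}
    {c d : ℝ} (hφ : ∀ x ∈ s, φ x ≤ c) (hl : ∀ x ∈ s, φ x = c → l x = d) (hd : ∃ x ∈ s, d < l x) :
    ∃ t > 0, (∀ x ∈ s, φ x + t * l x ≤ c + t * d) ∧
      ∃ x ∈ s, φ x ≠ c ∧ φ x + t * l x = c + t * d := by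
  obtain ⟨q, ⟨hq, hlq⟩, hmin⟩ := Set.exists_min_image {x ∈ s | d < l x}
    (fun x => (c - φ x) / (l x - d)) (hfin.sep _) hd
  have hφq : φ q ≠ c := fun h => hlq.ne' (hl q hq h)
  set t := (c - φ q) / (l q - d)
  have ht : 0 < t := div_pos (sub_pos.2 ((hφ q hq).lt_of_ne hφq)) (sub_pos.2 hlq)
  have htq : t * (l q - d) = c - φ q := div_mul_cancel₀ _ (sub_pos.2 hlq).ne'
  refine ⟨t, ht, fun x hx => ?_, q, hq, hφq, by linarith⟩
  rcases le_or_gt (l x) d with hlx | hlx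
  · linarith [hφ x hx, mul_le_mul_of_nonneg_left hlx ht.le]
  · have := (le_div_iff₀ (sub_pos.2 hlx)).1 (hmin x ⟨hx, hlx⟩)
    linarith

theorem vectorSpan_le_ker {s : Set V} {l : Dual ℝ V} {d : ℝ} (h : ∀ x ∈ s, l x = d) :
    vectorSpan ℝ s ≤ l.ker := by
  rw [vectorSpan_def, Submodule.span_le]
  rintro _ ⟨x, hx, y, hy, rfl⟩
  simp [h x hx, h y hy]

/-- A supporting hyperplane touching `s` in codimension at least two can be rotated around its
contact set until it touches `s` in a further point. -/
theorem IsExposedFace.exists_ssuperset {s t : Set V} (hfin : s.Finite) (h : IsExposedFace s t)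
    (hdim : finrank ℝ (vectorSpan ℝ t) + 1 < finrank ℝ (vectorSpan ℝ s)) :
    ∃ t', IsExposedFace s t' ∧ t ⊂ t' := by
  have := finiteDimensional_vectorSpan_of_finite ℝ hfin
  have := finiteDimensional_vectorSpan_of_finite ℝ (hfin.subset h.subset)
  obtain ⟨⟨v, hv⟩, -, φ, c, hφ, rfl⟩ := h
  obtain ⟨u, hu, hφu, l, hlu, hl⟩ := exists_dual_of_finrank_add_one_lt hdim φ
  obtain ⟨l, hlu, hl, hlt⟩ : ∃ l : Dual ℝ V, l u ≠ 0 ∧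
      vectorSpan ℝ {x ∈ s | φ x = c} ≤ l.ker ∧ ∃ x ∈ s, l v < l x := by
    by_contra! hcon
    have hge := hcon (-l) (by simpa using hlu) (by simpa using hl)
    have hconst : ∀ x ∈ s, l x = l v := fun x hx =>
      (hcon l hlu hl x hx).antisymm (by simpa using hge x hx)
    exact hlu (vectorSpan_le_ker hconst hu)
  have hlv : ∀ x ∈ s, φ x = c → l x = l v := fun x hx hxc => by
    have hx' : x ∈ {x ∈ s | φ x = c} := ⟨hx, hxc⟩
    simpa [sub_eq_zero] using hl (vsub_mem_vectorSpan ℝ hx' hv)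
  obtain ⟨t, ht, hle, q, hq, hqc, hqt⟩ := exists_add_mul_le_of_maximisers hfin hφ hlv hlt
  have hsub : {x ∈ s | φ x = c} ⊆ {x ∈ s | (φ + t • l) x = c + t * l v} := fun x hx =>
    ⟨hx.1, by simp [hx.2, hlv x hx.1 hx.2]⟩
  refine ⟨{x ∈ s | (φ + t • l) x = c + t * l v}, ⟨⟨v, hsub hv⟩, fun heq => ?_, _, _, hle, rfl⟩,
    hsub, fun hsup => hqc (hsup ⟨hq, hqt⟩).2⟩
  have hu0 := vectorSpan_le_ker (Set.sep_eq_self_iff_mem_true.1 heq) hu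
  simp [hφu, ht.ne', hlu] at hu0

theorem IsExposedFace.isExtreme_convexHull {s t : Set V} (h : IsExposedFace s t) :
    IsExtreme ℝ (convexHull ℝ s) (convexHull ℝ t) := by
  obtain ⟨-, -, φ, c, hφ, rfl⟩ := h
  have hle : convexHull ℝ s ⊆ {x | φ x ≤ c} := convexHull_min hφ (convex_halfSpace_le φ.isLinear c)
  have hext : IsExtreme ℝ (convexHull ℝ s) (convexHull ℝ s ∩ {x | φ x = c}) := by
    refine ⟨Set.inter_subset_left, fun x hx y hy z hz ⟨a, b, ha, hb, hab, hxyz⟩ => ⟨hx, ?_⟩⟩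
    have hz : a * φ x + b * φ y = c := by simpa [← hxyz] using hz.2
    have hy := mul_le_mul_of_nonneg_left (hle hy) hb.le
    exact (hle hx).antisymm (le_of_mul_le_mul_left (a := a) (by
      linear_combination hy - hz + c * hab) ha)
  have heq := eq_convexHull_inter_of_isExtreme
    ((convex_convexHull ℝ s).inter (convex_hyperplane φ.isLinear c)) hext
  rw [← Set.inter_assoc, Set.inter_eq_left.2 (subset_convexHull ℝ s)] at heq
  exact heq ▸ hext

theorem IsExposedFace.convexHull_ne {s t : Set V} (h : IsExposedFace s t) :
    convexHull ℝ t ≠ convexHull ℝ s := by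
  obtain ⟨-, hne, φ, c, -, rfl⟩ := h
  refine fun heq => hne (Set.sep_eq_self_iff_mem_true.2 fun x hx => ?_)
  exact convexHull_min (fun y hy => hy.2) (convex_hyperplane φ.isLinear c)
    (heq ▸ subset_convexHull ℝ s hx)

theorem IsPolytope.exists_facet {P : Set V} (hP : IsPolytope P)
    (hdim : 0 < finrank ℝ (vectorSpan ℝ P)) :
    ∃ F, Convex ℝ F ∧ IsExtreme ℝ P F ∧ F.Nonempty ∧ F ≠ P ∧
      finrank ℝ (vectorSpan ℝ P) ≤ finrank ℝ (vectorSpan ℝ F) + 1 := by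
  obtain ⟨s, rfl⟩ := hP
  have hs : (s : Set V).Nontrivial := by
    rw [← Set.not_subsingleton_iff]
    intro hsub
    rw [vectorSpan_convexHull, vectorSpan_of_subsingleton ℝ hsub, finrank_bot] at hdim
    exact hdim.false
  obtain ⟨t, ht : IsExposedFace _ t, hmax⟩ := (s.finite_toSet.finite_subsets.subset
    fun t (ht : IsExposedFace (s : Set V) t) => ht.subset).exists_maximal
      (exists_isExposedFace s.finite_toSet hs)
  refine ⟨convexHull ℝ t, convex_convexHull ℝ t, ht.isExtreme_convexHull,
    ht.1.convexHull, ht.convexHull_ne, not_lt.1 fun hlt => ?_⟩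
  rw [vectorSpan_convexHull, vectorSpan_convexHull] at hlt
  obtain ⟨t', ht', htt'⟩ := ht.exists_ssuperset s.finite_toSet hlt
  exact htt'.2 (hmax ht' htt'.1)

end Convex

section FaceLattice

open Module

variable {V W : Type*} [AddCommGroup V] [Module ℝ V] [AddCommGroup W] [Module ℝ W]
  {P : Set V} {Q : Set W}

theorem Faces.finrank_lt_finrank [FiniteDimensional ℝ (vectorSpan ℝ P)] {F G : Faces P}
    (hFG : F < G) (hF : F.1.Nonempty) :
    finrank ℝ (vectorSpan ℝ F.1) < finrank ℝ (vectorSpan ℝ G.1) :=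
  have := Submodule.finiteDimensional_of_le (vectorSpan_mono ℝ G.2.2.subset)
  finrank_vectorSpan_lt_of_isExtreme F.2.1 (F.2.2.mono G.2.2.subset hFG.le) hF
    fun h => hFG.ne (Subtype.ext h)

theorem Faces.nonempty_map {Φ : Faces P → Faces Q} (hΦ : StrictMono Φ) {F : Faces P}
    (hF : F.1.Nonempty) : (Φ F).1.Nonempty := by
  let E : Faces P := ⟨∅, convex_empty, Set.empty_subset _, fun _ _ _ _ _ h => h.elim⟩
  have hlt : Φ E < Φ F := hΦ (show E.1 < F.1 from Set.empty_ssubset.2 hF)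
  exact Set.nonempty_of_ssubset' (show (Φ E).1 ⊂ (Φ F).1 from hlt)

theorem Faces.finrank_le_finrank_map (hP : IsPolytope P) [FiniteDimensional ℝ (vectorSpan ℝ Q)]
    {Φ : Faces P → Faces Q} (hΦ : StrictMono Φ) (F : Faces P) :
    finrank ℝ (vectorSpan ℝ F.1) ≤ finrank ℝ (vectorSpan ℝ (Φ F).1) := by
  have := hP.finiteDimensional
  induction hn : finrank ℝ (vectorSpan ℝ F.1) using Nat.strong_induction_on generalizing F with
  | _ n ih =>
    rcases Nat.eq_zero_or_pos n with rfl | hpos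
    · exact Nat.zero_le _
    obtain ⟨G, hG, hFG, hGne, hGF, hdim⟩ :=
      (hP.of_isExtreme F.2.1 F.2.2).exists_facet (hn ▸ hpos)
    let G' : Faces P := ⟨G, hG, F.2.2.trans hFG⟩
    have hlt : G' < F := hFG.subset.lt_of_ne hGF
    have hGlt := Faces.finrank_lt_finrank hlt hGne
    have hle := ih _ (hn ▸ hGlt) G' rfl
    have hΦlt := Faces.finrank_lt_finrank (hΦ hlt) (Faces.nonempty_map hΦ hGne)
    change _ ≤ finrank ℝ (vectorSpan ℝ G) + 1 at hdim
    change finrank ℝ (vectorSpan ℝ G) ≤ _ at hle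
    omega

theorem Faces.finrank_map_eq (hP : IsPolytope P) (hQ : IsPolytope Q) (Φ : Faces P ≃o Faces Q)
    (F : Faces P) : finrank ℝ (vectorSpan ℝ (Φ F).1) = finrank ℝ (vectorSpan ℝ F.1) := by
  have := hP.finiteDimensional
  have := hQ.finiteDimensional
  refine le_antisymm ?_ (Faces.finrank_le_finrank_map hP Φ.strictMono F)
  have h := Faces.finrank_le_finrank_map hQ Φ.symm.strictMono (Φ F)
  rwa [Φ.symm_apply_apply] at h

end FaceLattice

/-! ### Faces of the cube -/

section Cube

open Module Topology

variable {ι : Type*}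

theorem isPolytope_Icc [Finite ι] : IsPolytope (Set.Icc (0 : ι → ℝ) 1) := by
  have hvert : convexHull ℝ (Set.univ.pi fun _ : ι => ({0, 1} : Set ℝ)) = Set.Icc 0 1 := by
    rw [convexHull_pi, ← Set.pi_univ_Icc]
    simp only [convexHull_pair, segment_eq_Icc zero_le_one, Pi.zero_apply, Pi.one_apply]
  rw [← hvert]
  exact isPolytope_convexHull_of_finite (Set.Finite.pi fun _ => Set.toFinite _)

/-- The section of the cube `[0, 1]^ι` through `p` in which the coordinates in `J` are free. It is
a face if all the other coordinates of `p` are `0` or `1`. -/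
def cubeFace (J : Set ι) (p : ι → ℝ) : Set (ι → ℝ) := {x ∈ Set.Icc 0 1 | ∀ i ∉ J, x i = p i}

theorem convex_cubeFace (J : Set ι) (p : ι → ℝ) : Convex ℝ (cubeFace J p) := by
  refine (convex_Icc _ _).inter fun x hx y hy a b _ _ hab i hi => ?_
  rw [Pi.add_apply, Pi.smul_apply, Pi.smul_apply, hx i hi, hy i hi, ← add_smul, hab, one_smul]

theorem isExtreme_cubeFace {J : Set ι} {p : ι → ℝ} (hp : ∀ i ∉ J, p i = 0 ∨ p i = 1) :
    IsExtreme ℝ (Set.Icc 0 1) (cubeFace J p) := by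
  refine ⟨Set.sep_subset _ _, fun x hx y hy z hz ⟨a, b, ha, hb, hab, hxyz⟩ => ⟨hx, fun i hi => ?_⟩⟩
  have hzi : a * x i + b * y i = p i := by simpa [← hxyz] using hz.2 i hi
  have hx0 : 0 ≤ x i := hx.1 i
  have hx1 : x i ≤ 1 := hx.2 i
  have hy0 : 0 ≤ y i := hy.1 i
  have hy1 : y i ≤ 1 := hy.2 i
  rcases hp i hi with hpi | hpi <;> rw [hpi] at hzi ⊢ <;> nlinarith

theorem update_mem_cubeFace [DecidableEq ι] {J : Set ι} {p : ι → ℝ} (hp : p ∈ Set.Icc 0 1)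
    {i : ι} (hi : i ∈ J) {t : ℝ} (ht : t ∈ Set.Icc 0 1) : Function.update p i t ∈ cubeFace J p := by
  refine ⟨⟨le_update_iff.2 ⟨ht.1, fun j _ => hp.1 j⟩, update_le_iff.2 ⟨ht.2, fun j _ => hp.2 j⟩⟩,
    fun j hj => ?_⟩
  exact Function.update_of_ne (by rintro rfl; exact hj hi) _ _

theorem cubeFace_subset_cubeFace_iff {J J' : Set ι} {p : ι → ℝ} (hp : p ∈ Set.Icc 0 1) :
    cubeFace J p ⊆ cubeFace J' p ↔ J ⊆ J' := by
  classical
  refine ⟨fun h i hi => ?_, fun h x hx => ⟨hx.1, fun i hi => hx.2 i fun hiJ => hi (h hiJ)⟩⟩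
  by_contra hi'
  have h0 := (h (update_mem_cubeFace hp hi ⟨le_rfl, zero_le_one⟩)).2 i hi'
  have h1 := (h (update_mem_cubeFace hp hi ⟨zero_le_one, le_rfl⟩)).2 i hi'
  rw [Function.update_self] at h0 h1
  exact zero_ne_one (h0.trans h1.symm)

theorem vectorSpan_cubeFace [Finite ι] [DecidableEq ι] {J : Set ι} {p : ι → ℝ}
    (hp : p ∈ Set.Icc 0 1) :
    vectorSpan ℝ (cubeFace J p) =
      Submodule.span ℝ (Set.range fun i : J => (Pi.single (i : ι) 1 : ι → ℝ)) := by
  have := Fintype.ofFinite ι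
  refine le_antisymm ?_ ?_
  · rw [vectorSpan_def, Submodule.span_le]
    rintro _ ⟨x, hx, y, hy, rfl⟩
    change x - y ∈ Submodule.span _ _
    rw [pi_eq_sum_univ' (x - y)]
    refine Submodule.sum_mem _ fun i _ => ?_
    by_cases hi : i ∈ J
    · exact Submodule.smul_mem _ _ (Submodule.subset_span ⟨⟨i, hi⟩, rfl⟩)
    · rw [Pi.sub_apply, hx.2 i hi, hy.2 i hi, sub_self, zero_smul]
      exact Submodule.zero_mem _
  · rw [Submodule.span_le]
    rintro _ ⟨⟨i, hi⟩, rfl⟩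
    have h := vsub_mem_vectorSpan ℝ (update_mem_cubeFace hp hi ⟨zero_le_one, le_rfl⟩)
      (update_mem_cubeFace hp hi ⟨le_rfl, zero_le_one⟩)
    rwa [vsub_eq_sub, ← Function.update_sub, sub_self, sub_zero] at h

theorem finrank_vectorSpan_cubeFace [Finite ι] {J : Set ι} {p : ι → ℝ} (hp : p ∈ Set.Icc 0 1) :
    finrank ℝ (vectorSpan ℝ (cubeFace J p)) = J.ncard := by
  classical
  have := Fintype.ofFinite ι
  have hli : LinearIndependent ℝ fun i : J => (Pi.single (i : ι) 1 : ι → ℝ) := by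
    simpa [Function.comp_def] using
      (Pi.basisFun ℝ ι).linearIndependent.comp ((↑) : J → ι) Subtype.val_injective
  rw [vectorSpan_cubeFace hp, finrank_span_eq_card hli, Set.fintypeCard_eq_ncard]

theorem exists_add_smul_sub_mem_Icc [Finite ι] {p x : ι → ℝ} (hp : p ∈ Set.Icc 0 1)
    (hx : ∀ i, p i ∉ Set.Ioo 0 1 → x i = p i) :
    ∃ t > (0 : ℝ), p + t • (p - x) ∈ Set.Icc 0 1 := by
  have hnhds : ∀ᶠ t in 𝓝[>] (0 : ℝ), ∀ i, (p + t • (p - x)) i ∈ Set.Icc (0 : ℝ) 1 := by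
    refine Filter.eventually_all.2 fun i => ?_
    by_cases hi : p i ∈ Set.Ioo 0 1
    · have hcont : Continuous fun t : ℝ => (p + t • (p - x)) i := by fun_prop
      refine nhdsWithin_le_nhds (hcont.continuousAt.eventually_mem (Icc_mem_nhds ?_ ?_))
      · simpa using hi.1
      · simpa using hi.2
    · simpa [hx i hi] using ⟨hp.1 i, hp.2 i⟩
  obtain ⟨t, ht, ht0⟩ := (hnhds.and self_mem_nhdsWithin).exists
  exact ⟨t, ht0, fun i => (ht i).1, fun i => (ht i).2⟩

/-- A point of `F` with a maximal set of coordinates in the open unit interval is a relative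
interior point of `F`. -/
theorem exists_eq_cubeFace [Finite ι] {F : Set (ι → ℝ)} (hF : Convex ℝ F)
    (hFe : IsExtreme ℝ (Set.Icc 0 1) F) {q : ι → ℝ} (hq : q ∈ F) :
    ∃ J : Set ι, (∀ i ∉ J, q i = 0 ∨ q i = 1) ∧ F = cubeFace J q := by
  let free (p : ι → ℝ) : Set ι := {i | p i ∈ Set.Ioo 0 1}
  obtain ⟨p, hp, hmax⟩ := Set.Finite.exists_maximalFor' free F (Set.toFinite _) ⟨q, hq⟩
  have hbdry : ∀ i ∉ free p, p i = 0 ∨ p i = 1 := fun i hi => by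
    have h : p i ∈ Set.Icc 0 1 \ Set.Ioo 0 1 := ⟨⟨(hFe.subset hp).1 i, (hFe.subset hp).2 i⟩, hi⟩
    rwa [Set.Icc_sdiff_Ioo_same zero_le_one] at h
  have hconst : ∀ x ∈ F, ∀ i ∉ free p, x i = p i := by
    intro x hx
    have hmid : ∀ i, p i ∈ Set.Ioo 0 1 ∨ x i ≠ p i → midpoint ℝ p x i ∈ Set.Ioo 0 1 := by
      intro i hi
      have hp0 : 0 ≤ p i := (hFe.subset hp).1 i
      have hp1 : p i ≤ 1 := (hFe.subset hp).2 i
      have hx0 : 0 ≤ x i := (hFe.subset hx).1 i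
      have hx1 : x i ≤ 1 := (hFe.subset hx).2 i
      rw [pi_midpoint_apply, midpoint_eq_smul_add, invOf_eq_inv, smul_eq_mul]
      rcases hi with ⟨h0, h1⟩ | hne
      · constructor <;> linarith
      · rcases hne.lt_or_gt with hlt | hlt <;> constructor <;> linarith
    have hle := hmax (hF.midpoint_mem hp hx) fun i hi => hmid i (.inl hi)
    exact fun i hi => of_not_not fun hne => hi (hle (hmid i (.inr hne)))
  refine ⟨free p, fun i hi => hconst q hq i hi ▸ hbdry i hi,
    Set.Subset.antisymm (fun x hx => ⟨hFe.subset hx, fun i hi => ?_⟩) fun x hx => ?_⟩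
  · rw [hconst x hx i hi, hconst q hq i hi]
  · obtain ⟨t, ht, hmem⟩ := exists_add_smul_sub_mem_Icc (hFe.subset hp) (x := x)
      fun i hi => (hx.2 i hi).trans (hconst q hq i hi)
    exact mem_of_isExtreme_of_add_smul_sub_mem hFe hp hx.1 ht hmem

theorem exists_face_Icc_ge [Finite ι] {κ : Type*} [Fintype κ]
    {C : Faces (Set.Icc (0 : ι → ℝ) 1)} (hC : C.1.Nonempty)
    {F : κ → Faces (Set.Icc (0 : ι → ℝ) 1)} (hCF : ∀ j, C ≤ F j)
    (hF : ∀ j, finrank ℝ (vectorSpan ℝ (F j).1) ≤ finrank ℝ (vectorSpan ℝ C.1) + 1) :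
    ∃ Q : Faces (Set.Icc (0 : ι → ℝ) 1), (∀ j, F j ≤ Q) ∧
      finrank ℝ (vectorSpan ℝ Q.1) ≤ finrank ℝ (vectorSpan ℝ C.1) + Fintype.card κ := by
  obtain ⟨q, hq⟩ := hC
  have hqc := C.2.2.subset hq
  obtain ⟨J, hJq, hJ⟩ := exists_eq_cubeFace C.2.1 C.2.2 hq
  choose K _ hK using fun j => exists_eq_cubeFace (F j).2.1 (F j).2.2 (hCF j hq)
  have hJK : ∀ j, J ⊆ K j := fun j => by
    rw [← cubeFace_subset_cubeFace_iff hqc, ← hJ, ← hK]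
    exact hCF j
  have hdiff : ∀ j, (K j \ J).ncard ≤ 1 := fun j => by
    have h := hF j
    rw [hK, hJ, finrank_vectorSpan_cubeFace hqc, finrank_vectorSpan_cubeFace hqc,
      ← Set.ncard_sdiff_add_ncard_of_subset (hJK j)] at h
    omega
  refine ⟨⟨cubeFace (J ∪ ⋃ j, K j \ J) q, convex_cubeFace _ _,
    isExtreme_cubeFace fun i hi => hJq i fun h => hi (.inl h)⟩, fun j => ?_, ?_⟩
  · change (F j).1 ⊆ cubeFace _ q
    rw [hK, cubeFace_subset_cubeFace_iff hqc]
    intro i hi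
    by_cases hiJ : i ∈ J
    · exact .inl hiJ
    · exact .inr (Set.mem_iUnion.2 ⟨j, hi, hiJ⟩)
  · have hunion : (⋃ j, K j \ J).ncard ≤ Fintype.card κ := by
      refine (Set.ncard_iUnion_le_of_fintype _).trans ?_
      exact (Finset.sum_le_card_nsmul _ _ 1 fun j _ => hdiff j).trans_eq (by simp)
    rw [hJ, finrank_vectorSpan_cubeFace hqc, finrank_vectorSpan_cubeFace hqc]
    exact (Set.ncard_union_le _ _).trans (Nat.add_le_add_left hunion _)

theorem IsCombinatorialHypercube.exists_face_ge {V : Type*} [AddCommGroup V] [Module ℝ V]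
    {D : Set V} (hD : IsCombinatorialHypercube D) {κ : Type*} [Fintype κ] {C : Faces D}
    (hC : C.1.Nonempty) {F : κ → Faces D} (hCF : ∀ j, C ≤ F j)
    (hF : ∀ j, finrank ℝ (vectorSpan ℝ (F j).1) ≤ finrank ℝ (vectorSpan ℝ C.1) + 1) :
    ∃ Q : Faces D, (∀ j, F j ≤ Q) ∧
      finrank ℝ (vectorSpan ℝ Q.1) ≤ finrank ℝ (vectorSpan ℝ C.1) + Fintype.card κ := by
  obtain ⟨hP, n, ⟨Φ⟩⟩ := hD
  have hdim := Faces.finrank_map_eq hP isPolytope_Icc Φ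
  simp only [← hdim] at hF ⊢
  obtain ⟨Q, hQ, hQdim⟩ := exists_face_Icc_ge (Faces.nonempty_map Φ.strictMono hC)
    (fun j => Φ.monotone (hCF j)) hF
  exact ⟨Φ.symm Q, fun j => Φ.le_symm_apply.2 (hQ j), by rwa [Φ.apply_symm_apply]⟩

end Cube

/-! ### Weak compatibility of `d`-splits -/

section Splits

variable {X : Type*}

/-- `S` separates `{x, y}` from `{z, w}`: the quartet `xy|zw` is displayed by `S`. -/
def Split.Separates (S : Split X) (x y z w : X) : Prop :=
  S.delta x y = 0 ∧ S.delta z w = 0 ∧ S.delta x z = 1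

open Classical in
theorem Split.exists_side (S : Split X) : ∃ A : Set X, S.1 = s(A, Aᶜ) ∧
    ∀ x y, S.delta x y = if x ∈ A ↔ y ∈ A then 0 else 1 := by
  obtain ⟨S, A, B, rfl, -, -, hAB, hU⟩ := S
  obtain rfl : B = Aᶜ := (isCompl_iff.2 ⟨hAB, codisjoint_iff.2 hU⟩).compl_eq.symm
  refine ⟨A, rfl, fun x y => ?_⟩
  simp only [Split.delta, Sym2.mem_iff, exists_eq_or_imp, exists_eq_left, Set.mem_compl_iff]
  congr 1
  rw [← iff_iff_and_or_not_and_not]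

theorem Split.separates_of_delta_add_lt {S : Split X} {x y z w : X}
    (h : S.delta x y + S.delta z w < S.delta x z + S.delta y w) : S.Separates x y z w := by
  obtain ⟨A, -, hA⟩ := S.exists_side
  simp only [Separates, hA] at h ⊢
  by_cases x ∈ A <;> by_cases y ∈ A <;> by_cases z ∈ A <;> by_cases w ∈ A <;>
    simp_all <;> linarith

theorem Split.Separates.swap_right {S : Split X} {x y z w : X} (h : S.Separates x y z w) :
    S.Separates x y w z := by
  obtain ⟨A, -, hA⟩ := S.exists_side
  simp only [Separates, hA] at h ⊢
  grind

theorem Split.Separates.of_not_separates {S : Split X} {x y z w v : X} (h : S.Separates x y z w)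
    (hv : ¬ S.Separates x y z v) : S.Separates x v z w := by
  obtain ⟨A, -, hA⟩ := S.exists_side
  simp only [Separates, hA] at h hv ⊢
  grind

theorem Split.separates_of_delta_add_add_lt {S : Split X} {x y z v w : X}
    (h : S.delta x y + S.delta z v + S.delta x w < S.delta x z + S.delta x v + S.delta y w)
    (hv : ¬ S.Separates x y z v) : S.Separates x w v z := by
  obtain ⟨A, -, hA⟩ := S.exists_side
  simp only [Separates, hA] at h hv ⊢
  by_cases x ∈ A <;> by_cases y ∈ A <;> by_cases z ∈ A <;> by_cases w ∈ A <;> by_cases v ∈ A <;>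
    simp_all <;> linarith

variable [PseudoMetricSpace X]

theorem add_dist_lt_max_of_isolationIndex_pos {A B : Set X} (h : 0 < isolationIndex A B)
    {a a' b b' : X} (ha : a ∈ A) (ha' : a' ∈ A) (hb : b ∈ B) (hb' : b' ∈ B) :
    dist a a' + dist b b' < max (dist a b + dist a' b') (dist a' b + dist a b') := by
  contrapose! h
  have hmax : max (dist a b + dist a' b') (max (dist a' b + dist a b') (dist a a' + dist b b'))
      - dist a a' - dist b b' = 0 := by
    rw [← max_assoc, max_eq_right h]
    ring
  refine mul_nonpos_of_nonneg_of_nonpos (by norm_num)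
    (csInf_le ⟨0, ?_⟩ ⟨a, ha, a', ha', b, hb, b', hb', hmax.symm⟩)
  rintro r ⟨a, -, a', -, b, -, b', -, rfl⟩
  have : dist a a' + dist b b' ≤ max (dist a b + dist a' b')
    (max (dist a' b + dist a b') (dist a a' + dist b b')) := by simp
  linarith

theorem add_dist_lt_max_of_separates {S : Split X} (hS : S ∈ dSplits X) {x y z w : X}
    (h : S.Separates x y z w) :
    dist x y + dist z w < max (dist x z + dist y w) (dist y z + dist x w) := by
  obtain ⟨A, hSA, hA⟩ := S.exists_side
  have hpos : 0 < isolationIndex A Aᶜ := by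
    simpa only [dSplits, Set.mem_ofPred_eq, Split.alpha, hSA, Sym2.lift_mk] using hS
  obtain ⟨hxy, hzw, hxz⟩ : (x ∈ A ↔ y ∈ A) ∧ (z ∈ A ↔ w ∈ A) ∧ ¬ (x ∈ A ↔ z ∈ A) := by
    simpa only [Split.Separates, hA, ite_eq_left_iff, ite_eq_right_iff, one_ne_zero,
      zero_ne_one, imp_false, not_not] using h
  by_cases hx : x ∈ A
  · exact add_dist_lt_max_of_isolationIndex_pos hpos hx (hxy.1 hx)
      (show z ∉ A by tauto) (show w ∉ A by tauto)
  · rw [isolationIndex_comm] at hpos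
    exact add_dist_lt_max_of_isolationIndex_pos hpos hx (show y ∉ A by tauto)
      (show z ∈ A by tauto) (show w ∈ A by tauto)

theorem dSplits_weaklyCompatible {S T U : Split X} (hS : S ∈ dSplits X) (hT : T ∈ dSplits X)
    (hU : U ∈ dSplits X) {x y z w : X} (hSx : S.Separates x y z w) (hTx : T.Separates x z y w) :
    ¬ U.Separates x w y z := by
  intro hUx
  have hS' := add_dist_lt_max_of_separates hS hSx
  have hT' := add_dist_lt_max_of_separates hT hTx
  have hU' := add_dist_lt_max_of_separates hU hUx
  rw [dist_comm z y] at hT'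
  rw [dist_comm w z, dist_comm w y] at hU'
  grind

theorem TotallySplitDecomposable.exists_sum_delta_lt (h : TotallySplitDecomposable X)
    {ι κ : Type*} [Fintype ι] [Fintype κ] {p q : ι → X} {p' q' : κ → X}
    (hlt : ∑ i, dist (p i) (q i) < ∑ j, dist (p' j) (q' j)) :
    ∃ S ∈ dSplits X, ∑ i, S.delta (p i) (q i) < ∑ j, S.delta (p' j) (q' j) := by
  by_contra! hle
  refine hlt.not_ge (hasSum_le (fun S => ?_) (hasSum_sum fun j _ => h (p' j) (q' j))
    (hasSum_sum fun i _ => h (p i) (q i)))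
  simp only [← Finset.mul_sum]
  exact mul_le_mul_of_nonneg_left (hle S.1 S.2) (le_of_lt S.2)

/-- If the quartet inequality fails, then no `d`-split displays `xy|zz'`, and the assumptions on
`g` produce three `d`-splits displaying the three quartets of `{x, z, z', w}`. -/
theorem add_dist_lt_max_of_not_edge (h : TotallySplitDecomposable X) {g : X → ℝ}
    (hg : g ∈ Delta X) {x y z z' w : X} (hxz : g x + g z = dist x z)
    (hxz' : g x + g z' = dist x z') (hyw : g y + g w = dist y w) (hxy : g x + g y ≠ dist x y) :
    dist x y + dist z z' < max (dist x z + dist y z') (dist y z + dist x z') := by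
  by_contra hmax
  have hxy : dist x y < g x + g y := lt_of_le_of_ne (hg x y) hxy.symm
  have hno : ∀ S ∈ dSplits X, ¬ S.Separates x y z z' :=
    fun S hS hsep => hmax (add_dist_lt_max_of_separates hS hsep)
  have hno' : ∀ S ∈ dSplits X, ¬ S.Separates x y z' z := fun S hS hsep => hno S hS hsep.swap_right
  obtain ⟨S, hS, hSlt⟩ := h.exists_sum_delta_lt (p := ![x, z]) (q := ![y, w])
    (p' := ![x, y]) (q' := ![z, w]) (by
      simp only [Fin.sum_univ_two, Matrix.cons_val]
      linarith [hg z w])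
  obtain ⟨T, hT, hTlt⟩ := h.exists_sum_delta_lt (p := ![x, z']) (q := ![y, w])
    (p' := ![x, y]) (q' := ![z', w]) (by
      simp only [Fin.sum_univ_two, Matrix.cons_val]
      linarith [hg z' w])
  obtain ⟨U, hU, hUlt⟩ := h.exists_sum_delta_lt (p := ![x, z, x]) (q := ![y, z', w])
    (p' := ![x, x, y]) (q' := ![z, z', w]) (by
      simp only [Fin.sum_univ_three, Matrix.cons_val]
      linarith [hg z z', hg x w])
  simp only [Fin.sum_univ_two, Fin.sum_univ_three, Matrix.cons_val] at hSlt hTlt hUlt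
  exact dSplits_weaklyCompatible hS hT hU
    ((Split.separates_of_delta_add_lt hSlt).of_not_separates (hno S hS))
    ((Split.separates_of_delta_add_lt hTlt).of_not_separates (hno' T hT))
    (Split.separates_of_delta_add_add_lt hUlt (hno U hU))

end Splits

/-! ### Cells and their relative interior points -/

section Cells

variable {X : Type*} [PseudoMetricSpace X]

theorem mk_mem_edges {f : X → ℝ} {x y : X} : s(x, y) ∈ edges f ↔ f x + f y = dist x y := by
  refine ⟨?_, fun h => ⟨x, y, rfl, h⟩⟩
  rintro ⟨a, b, hab, h⟩
  rcases Sym2.eq_iff.1 hab with ⟨rfl, rfl⟩ | ⟨rfl, rfl⟩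
  · exact h
  · rw [add_comm, h, dist_comm]

theorem edges_subset_edges {f g : X → ℝ} :
    edges f ⊆ edges g ↔ ∀ x y, f x + f y = dist x y → g x + g y = dist x y := by
  simp only [← mk_mem_edges]
  exact ⟨fun h x y hxy => h hxy, fun h e => Sym2.inductionOn e h⟩

theorem exists_edge {f : X → ℝ} (hf : f ∈ hull' X) (x : X) : ∃ y, f x + f y = dist x y := by
  obtain ⟨e, he, y, rfl⟩ := hf.2 x
  exact ⟨y, mk_mem_edges.1 he⟩

theorem mem_hull'_of_edges_subset {f g : X → ℝ} (hf : f ∈ hull' X) (hg : g ∈ Delta X)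
    (h : edges f ⊆ edges g) : g ∈ hull' X :=
  ⟨hg, fun x => (hf.2 x).imp fun _ he => ⟨h he.1, he.2⟩⟩

theorem hull_subset_Delta : hull X ⊆ Delta X := fun f hf x y => by
  linarith [show dist x y - f y ≤ f x from (hf x).1 ⟨y, rfl⟩]

theorem hull'_subset_hull : hull' X ⊆ hull X := fun f hf x => by
  refine IsGreatest.isLUB ⟨?_, ?_⟩
  · obtain ⟨y, hy⟩ := exists_edge hf x
    exact ⟨y, by linarith⟩
  · rintro _ ⟨y, rfl⟩
    exact sub_le_iff_le_add.2 (hf.1 x y)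

theorem convex_Delta : Convex ℝ (Delta X) := by
  intro f hf g hg a b ha hb hab x y
  have hf := mul_le_mul_of_nonneg_left (hf x y) ha
  have hg := mul_le_mul_of_nonneg_left (hg x y) hb
  simp only [Pi.add_apply, Pi.smul_apply, smul_eq_mul]
  linear_combination hf + hg - hab * dist x y

theorem edges_of_mem_openSegment {f g h : X → ℝ} (hf : f ∈ Delta X) (hg : g ∈ Delta X)
    (hh : h ∈ openSegment ℝ f g) : edges h = edges f ∩ edges g := by
  obtain ⟨a, b, ha, hb, hab, rfl⟩ := hh
  ext ⟨x, y⟩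
  simp only [Set.mem_inter_iff, mk_mem_edges, Pi.add_apply, Pi.smul_apply, smul_eq_mul]
  have hsplit : a * f x + b * g x + (a * f y + b * g y) - dist x y =
      a * (f x + f y - dist x y) + b * (g x + g y - dist x y) := by
    linear_combination hab * dist x y
  have hf := mul_nonneg ha.le (sub_nonneg.2 (hf x y))
  have hg := mul_nonneg hb.le (sub_nonneg.2 (hg x y))
  rw [← sub_eq_zero, hsplit, add_eq_zero_iff_of_nonneg hf hg, mul_eq_zero_iff_left ha.ne',
    mul_eq_zero_iff_left hb.ne', sub_eq_zero, sub_eq_zero]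

/-- The cell `E(X, d) ∩ H(A(f))` of the injective hull determined by `f`. -/
def cellOf (f : X → ℝ) : Set (X → ℝ) := hull X ∩ (affH (edges f) : Set (X → ℝ))

theorem mem_cellOf {f g : X → ℝ} (hf : f ∈ hull' X) :
    g ∈ cellOf f ↔ g ∈ Delta X ∧ edges f ⊆ edges g := by
  have haff : g ∈ (affH (edges f) : Set (X → ℝ)) ↔ edges f ⊆ edges g := by
    simp only [edges_subset_edges, ← mk_mem_edges (f := f)]
    rfl
  rw [cellOf, Set.mem_inter_iff, haff]
  exact ⟨fun h => ⟨hull_subset_Delta h.1, h.2⟩,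
    fun h => ⟨hull'_subset_hull (mem_hull'_of_edges_subset hf h.1 h.2), h.2⟩⟩

theorem self_mem_cellOf {f : X → ℝ} (hf : f ∈ hull' X) : f ∈ cellOf f :=
  (mem_cellOf hf).2 ⟨hf.1, subset_rfl⟩

theorem mem_hull'_of_mem_cellOf {f g : X → ℝ} (hf : f ∈ hull' X) (hg : g ∈ cellOf f) :
    g ∈ hull' X :=
  have hg := (mem_cellOf hf).1 hg
  mem_hull'_of_edges_subset hf hg.1 hg.2

theorem convex_cellOf {f : X → ℝ} (hf : f ∈ hull' X) : Convex ℝ (cellOf f) := by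
  refine convex_iff_openSegment_subset.2 fun g hg g' hg' h hh => ?_
  rw [mem_cellOf hf] at hg hg' ⊢
  refine ⟨convex_Delta.openSegment_subset hg.1 hg'.1 hh, ?_⟩
  rw [edges_of_mem_openSegment hg.1 hg'.1 hh]
  exact Set.subset_inter hg.2 hg'.2

theorem isExtreme_cellOf {f g : X → ℝ} (hf : f ∈ hull' X) (hg : g ∈ cellOf f) :
    IsExtreme ℝ (cellOf f) (cellOf g) := by
  have hg' := mem_hull'_of_mem_cellOf hf hg
  refine ⟨fun u hu => ?_, fun u hu v hv w hw huvw => ?_⟩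
  · rw [mem_cellOf hg'] at hu
    exact (mem_cellOf hf).2 ⟨hu.1, ((mem_cellOf hf).1 hg).2.trans hu.2⟩
  · rw [mem_cellOf hf] at hu hv
    rw [mem_cellOf hg', edges_of_mem_openSegment hu.1 hv.1 huvw] at hw
    exact (mem_cellOf hg').2 ⟨hu.1, hw.2.trans Set.inter_subset_left⟩

/-- A Helly property of the neighbourhoods of `x` in three edge graphs: if each two of them meet
but all three do not, then add up the strict quartet inequalities of the three meeting points. -/
theorem exists_common_edge (h : TotallySplitDecomposable X) {f g k : X → ℝ}
    (hf : f ∈ hull' X) (hg : g ∈ hull' X) (hk : k ∈ hull' X) {x : X}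
    (hfg : ∃ y, f x + f y = dist x y ∧ g x + g y = dist x y)
    (hfk : ∃ y, f x + f y = dist x y ∧ k x + k y = dist x y)
    (hgk : ∃ y, g x + g y = dist x y ∧ k x + k y = dist x y) :
    ∃ y, f x + f y = dist x y ∧ g x + g y = dist x y ∧ k x + k y = dist x y := by
  obtain ⟨r, hfr, hgr⟩ := hfg
  obtain ⟨q, hfq, hkq⟩ := hfk
  obtain ⟨p, hgp, hkp⟩ := hgk
  by_contra! hcon
  obtain ⟨u, hu⟩ := exists_edge hf p
  obtain ⟨v, hv⟩ := exists_edge hg q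
  obtain ⟨w, hw⟩ := exists_edge hk r
  have hp := add_dist_lt_max_of_not_edge h hf.1 hfq hfr hu fun e => hcon p e hgp hkp
  have hq := add_dist_lt_max_of_not_edge h hg.1 hgp hgr hv fun e => hcon q hfq e hkq
  have hr := add_dist_lt_max_of_not_edge h hk.1 hkp hkq hw fun e => hcon r hfr hgr e
  rw [lt_max_iff] at hp hq hr
  rw [dist_comm q p] at hq
  rw [dist_comm r p, dist_comm r q] at hr
  rcases hp with hp | hp <;> rcases hq with hq | hq <;> rcases hr with hr | hr <;> linarith

end Cells

section Slack

open Real Polynomial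

theorem exists_lipschitzWith_of_periodic {φ : ℝ → ℝ} {c : ℝ} (hφ : Function.Periodic φ c)
    (hc : c ≠ 0) (hdiff : ContDiff ℝ 1 φ) : ∃ K, LipschitzWith K φ := by
  have hper : Function.Periodic (deriv φ) c := fun t => by
    rw [← deriv_comp_add_const, hφ.funext]
  obtain ⟨K, hK⟩ := (hper.isBounded_of_continuous hc hdiff.continuous_deriv_one).exists_norm_le
  exact ⟨K.toNNReal, lipschitzWith_of_nnnorm_deriv_le (hdiff.differentiable one_ne_zero) fun t =>
    NNReal.le_toNNReal_of_coe_le (hK _ ⟨t, rfl⟩)⟩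

variable {X : Type*} [PseudoMetricSpace X]

/-- For integral distances `|φ (f x) + φ (f y)|` is at most a multiple of the slack
`f x + f y - d(x, y)`, so small multiples of `φ ∘ f` can be added to `f` within its cell. -/
theorem comp_mem_vectorSpan_cellOf (hint : IntegerValued X) {f : X → ℝ} (hf : f ∈ hull' X)
    {φ : ℝ → ℝ} (hodd : φ.Odd) (hper : Function.Periodic φ 1) {K : NNReal}
    (hφ : LipschitzWith K φ) : φ ∘ f ∈ vectorSpan ℝ (cellOf f) := by
  have hbound : ∀ x y, |φ (f x) + φ (f y)| ≤ (K + 1) * (f x + f y - dist x y) := fun x y => by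
    obtain ⟨n, hn⟩ := hint x y
    have hy : φ (n - f y) = -φ (f y) := by
      rw [← hodd, sub_eq_neg_add]
      simpa using hper.int_mul n (-f y)
    have hle := hφ.dist_le_mul (f x) (n - f y)
    have hslack : 0 ≤ f x + f y - dist x y := sub_nonneg.2 (hf.1 x y)
    rw [Real.dist_eq, Real.dist_eq, hy, sub_neg_eq_add, ← hn,
      show f x - (dist x y - f y) = f x + f y - dist x y by ring, abs_of_nonneg hslack] at hle
    linarith
  set t : ℝ := (K + 1 : ℝ)⁻¹ with ht
  have ht0 : 0 < t := by positivity
  have hmem : f + t • (φ ∘ f) ∈ cellOf f := by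
    have hbound' : ∀ x y, |t * (φ (f x) + φ (f y))| ≤ f x + f y - dist x y := fun x y => by
      rw [abs_mul, abs_of_pos ht0, ht, inv_mul_le_iff₀ (by positivity)]
      exact hbound x y
    have hsum : ∀ x y, (f + t • (φ ∘ f)) x + (f + t • (φ ∘ f)) y =
        f x + f y + t * (φ (f x) + φ (f y)) := fun x y => by
      simp only [Pi.add_apply, Pi.smul_apply, Function.comp_apply, smul_eq_mul]
      ring
    refine (mem_cellOf hf).2 ⟨fun x y => ?_, edges_subset_edges.2 fun x y hxy => ?_⟩
    · linarith [hsum x y, neg_le_of_abs_le (hbound' x y)]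
    · have hzero : t * (φ (f x) + φ (f y)) = 0 :=
        abs_nonpos_iff.1 ((hbound' x y).trans_eq (sub_eq_zero.2 hxy))
      rw [hsum, hzero, add_zero, hxy]
  have hsmul := vsub_mem_vectorSpan ℝ hmem (self_mem_cellOf hf)
  rwa [vsub_eq_sub, add_sub_cancel_left, Submodule.smul_mem_iff _ ht0.ne'] at hsmul

theorem finite_range_cos (hint : IntegerValued X) {f : X → ℝ} (hf : f ∈ hull' X)
    [FiniteDimensional ℝ (vectorSpan ℝ (cellOf f))] :
    (Set.range fun x => cos (2 * π * f x)).Finite := by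
  let L : ℝ[X] →ₗ[ℝ] X → ℝ := LinearMap.pi fun x =>
    sin (2 * π * f x) • Polynomial.leval (cos (2 * π * f x))
  have hL : ∀ p, L p ∈ vectorSpan ℝ (cellOf f) := fun p => by
    let φ : ℝ → ℝ := fun t => sin (2 * π * t) * p.eval (cos (2 * π * t))
    have hper : Function.Periodic φ 1 := fun t => by simp [φ, mul_add]
    have hodd : φ.Odd := fun t => by simp [φ]
    obtain ⟨K, hK⟩ := exists_lipschitzWith_of_periodic hper one_ne_zero
      ((by fun_prop : ContDiff ℝ 1 fun t : ℝ => sin (2 * π * t)).mul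
        ((Polynomial.contDiff_aeval p 1).comp (by fun_prop)))
    exact comp_mem_vectorSpan_cellOf hint hf hodd hper hK
  obtain ⟨p, hp, hp0⟩ : ∃ p, L p = 0 ∧ p ≠ 0 := by
    by_contra! hinj
    exact Polynomial.not_finite (R := ℝ) <| Module.Finite.of_injective (L.codRestrict _ hL) <|
      (injective_iff_map_eq_zero _).2 fun p hp => hinj p (congrArg Subtype.val hp)
  refine ((p.roots.toFinset.finite_toSet).union (Set.toFinite {1, -1})).subset ?_
  rintro _ ⟨x, rfl⟩
  have hx : sin (2 * π * f x) = 0 ∨ p.eval (cos (2 * π * f x)) = 0 :=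
    mul_eq_zero.1 (congrFun hp x)
  refine hx.symm.imp (fun h => ?_) fun h => ?_
  · simpa using ⟨hp0, h⟩
  · exact Real.sin_eq_zero_iff_cos_eq.1 h

open scoped Pointwise in
theorem finite_range_cos_slack (hint : IntegerValued X) {f : X → ℝ}
    (hcos : (Set.range fun x => cos (2 * π * f x)).Finite) :
    (Set.range fun p : X × X => cos (2 * π * (f p.1 + f p.2 - dist p.1 p.2))).Finite := by
  have hsin : (Set.range fun x => sin (2 * π * f x)).Finite := by
    refine ((hcos.image fun c => √(1 - c ^ 2)).union (hcos.image fun c => -√(1 - c ^ 2))).subset ?_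
    rintro _ ⟨x, rfl⟩
    have habs := abs_sin_eq_sqrt_one_sub_cos_sq (2 * π * f x)
    exact (eq_or_eq_neg_of_abs_eq habs).imp (fun h => ⟨_, ⟨x, rfl⟩, h.symm⟩)
      fun h => ⟨_, ⟨x, rfl⟩, h.symm⟩
  refine ((hcos.mul hcos).sub (hsin.mul hsin)).subset ?_
  rintro _ ⟨⟨x, y⟩, rfl⟩
  obtain ⟨n, hn⟩ := hint x y
  have hcos_add : cos (2 * π * (f x + f y - dist x y)) = cos (2 * π * f x + 2 * π * f y) := by
    rw [hn, ← cos_sub_int_mul_two_pi (_ + _) n]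
    ring_nf
  simp only [hcos_add, cos_add]
  exact Set.sub_mem_sub (Set.mul_mem_mul ⟨x, rfl⟩ ⟨y, rfl⟩) (Set.mul_mem_mul ⟨x, rfl⟩ ⟨y, rfl⟩)

theorem exists_slack_gap (hint : IntegerValued X) {f : X → ℝ} (hf : f ∈ hull' X)
    [FiniteDimensional ℝ (vectorSpan ℝ (cellOf f))] :
    ∃ ε > 0, ∀ x y, f x + f y ≠ dist x y → ε ≤ f x + f y - dist x y := by
  have hfin := finite_range_cos_slack hint (finite_range_cos hint hf)
  obtain ⟨η, hη, hball⟩ := Metric.isOpen_iff.1 (hfin.sdiff (t := {1})).isClosed.isOpen_compl 1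
    fun h => h.2 rfl
  refine ⟨min 1 (η / (2 * π)), by positivity, fun x y hxy => ?_⟩
  have hpos : 0 < f x + f y - dist x y := sub_pos.2 ((hf.1 x y).lt_of_ne' hxy)
  by_cases hcos : cos (2 * π * (f x + f y - dist x y)) = 1
  · obtain ⟨n, hn⟩ := (cos_eq_one_iff _).1 hcos
    have hn : (n : ℝ) = f x + f y - dist x y :=
      mul_right_cancel₀ two_pi_pos.ne' (hn.trans (mul_comm _ _))
    rw [← hn] at hpos ⊢
    exact (min_le_left _ _).trans (by exact_mod_cast Int.add_one_le_of_lt (Int.cast_pos.1 hpos))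
  · have hη' : η ≤ |cos (2 * π * (f x + f y - dist x y)) - cos 0| := by
      rw [cos_zero, ← Real.dist_eq]
      exact not_lt.1 fun h => hball h ⟨⟨(x, y), rfl⟩, hcos⟩
    have hlip := hη'.trans (abs_cos_sub_cos_le _ _)
    rw [sub_zero, abs_of_pos (by positivity)] at hlip
    exact (min_le_right _ _).trans ((div_le_iff₀' two_pi_pos).2 hlip)

end Slack

section RelativeInterior

variable {X : Type*} [PseudoMetricSpace X]

theorem exists_abs_sub_le {f g : X → ℝ} (hf : f ∈ hull' X) (hg : g ∈ hull' X) :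
    ∃ M, ∀ x, |f x - g x| ≤ M := by
  rcases isEmpty_or_nonempty X with _ | ⟨⟨z⟩⟩
  · exact ⟨0, isEmptyElim⟩
  have hle : ∀ f ∈ hull' X, ∀ g ∈ hull' X, ∀ x, f x - g x ≤ f z + g z := fun f hf g hg x => by
    obtain ⟨y, hy⟩ := exists_edge hf x
    linarith [dist_triangle x z y, hf.1 z y, hg.1 x z]
  exact ⟨f z + g z, fun x => abs_le.2 ⟨by linarith [hle g hg f hf x], hle f hf g hg x⟩⟩

theorem exists_add_smul_sub_mem_cellOf (hint : IntegerValued X) {f g : X → ℝ} (hf : f ∈ hull' X)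
    [FiniteDimensional ℝ (vectorSpan ℝ (cellOf f))] (hg : g ∈ cellOf f) :
    ∃ t > (0 : ℝ), f + t • (f - g) ∈ cellOf f := by
  obtain ⟨ε, hε, hgap⟩ := exists_slack_gap hint hf
  obtain ⟨M, hM⟩ := exists_abs_sub_le hf (mem_hull'_of_mem_cellOf hf hg)
  have hfg := edges_subset_edges.1 ((mem_cellOf hf).1 hg).2
  set t := ε / (2 * |M| + 1) with ht
  have ht0 : 0 < t := by positivity
  have htM : t * (2 * |M|) ≤ ε := by
    rw [ht, div_mul_eq_mul_div, div_le_iff₀ (by positivity)]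
    linarith
  have hsum : ∀ x y, (f + t • (f - g)) x + (f + t • (f - g)) y =
      f x + f y + t * ((f x - g x) + (f y - g y)) := fun x y => by
    simp only [Pi.add_apply, Pi.smul_apply, Pi.sub_apply, smul_eq_mul]
    ring
  have hedge : ∀ x y, f x + f y = dist x y →
      (f + t • (f - g)) x + (f + t • (f - g)) y = dist x y := fun x y hxy => by
    rw [hsum]
    linear_combination (1 + t) * hxy - t * hfg x y hxy
  refine ⟨t, ht0, (mem_cellOf hf).2 ⟨fun x y => ?_, edges_subset_edges.2 hedge⟩⟩
  by_cases hxy : f x + f y = dist x y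
  · exact (hedge x y hxy).ge
  · have hdiff : -(2 * |M|) ≤ (f x - g x) + (f y - g y) := by
      linarith [neg_le_of_abs_le (hM x), neg_le_of_abs_le (hM y), le_abs_self M]
    linarith [hsum x y, hgap x y hxy, mul_le_mul_of_nonneg_left hdiff ht0.le]

theorem eq_cellOf_of_isExtreme (hint : IntegerValued X) {f : X → ℝ} (hf : f ∈ hull' X)
    [FiniteDimensional ℝ (vectorSpan ℝ (cellOf f))] {F : Set (X → ℝ)}
    (hF : IsExtreme ℝ (cellOf f) F) (hfF : f ∈ F) : F = cellOf f := by
  refine hF.subset.antisymm fun g hg => ?_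
  obtain ⟨t, ht, hmem⟩ := exists_add_smul_sub_mem_cellOf hint hf hg
  exact mem_of_isExtreme_of_add_smul_sub_mem hF hfF hg ht hmem

end RelativeInterior

/-! ### The link condition -/

section LinkCondition

open Module

variable {X : Type*} [PseudoMetricSpace X]

theorem cellOf_mem_cells {f : X → ℝ} (hf : f ∈ hull' X) : cellOf f ∈ cells X := ⟨f, hf, rfl⟩

theorem edges_midpoint {f g : X → ℝ} (hf : f ∈ Delta X) (hg : g ∈ Delta X) :
    edges (midpoint ℝ f g) = edges f ∩ edges g :=
  edges_of_mem_openSegment hf hg (midpoint_mem_openSegment f g)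

theorem finrank_vectorSpan_cellOf_lt {f g : X → ℝ} [FiniteDimensional ℝ (vectorSpan ℝ (cellOf f))]
    (hf : f ∈ hull' X) (hg : g ∈ cellOf f) (hne : cellOf g ≠ cellOf f) :
    finrank ℝ (vectorSpan ℝ (cellOf g)) < finrank ℝ (vectorSpan ℝ (cellOf f)) :=
  have hg' := mem_hull'_of_mem_cellOf hf hg
  finrank_vectorSpan_lt_of_isExtreme (convex_cellOf hg') (isExtreme_cellOf hf hg)
    ⟨g, self_mem_cellOf hg'⟩ hne

theorem edges_inter_of_facets {f e e' : X → ℝ} [FiniteDimensional ℝ (vectorSpan ℝ (cellOf f))]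
    (hf : f ∈ hull' X) (he : e ∈ cellOf f) (he' : e' ∈ cellOf f) {m : ℕ}
    (hdim : finrank ℝ (vectorSpan ℝ (cellOf e)) = m)
    (hdim' : finrank ℝ (vectorSpan ℝ (cellOf e')) = m)
    (hdimf : finrank ℝ (vectorSpan ℝ (cellOf f)) ≤ m + 1) (hne : cellOf e ≠ cellOf e') :
    edges e ∩ edges e' = edges f := by
  obtain ⟨heΔ, hfe⟩ := (mem_cellOf hf).1 he
  obtain ⟨heΔ', hfe'⟩ := (mem_cellOf hf).1 he'
  have hedges := edges_midpoint heΔ heΔ'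
  have hc : midpoint ℝ e e' ∈ cellOf f := (convex_cellOf hf).midpoint_mem he he'
  have hc' := mem_hull'_of_mem_cellOf hf hc
  have := Submodule.finiteDimensional_of_le (vectorSpan_mono ℝ (isExtreme_cellOf hf hc).subset)
  have hec : e ∈ cellOf (midpoint ℝ e e') :=
    (mem_cellOf hc').2 ⟨heΔ, hedges ▸ Set.inter_subset_left⟩
  have hec' : e' ∈ cellOf (midpoint ℝ e e') :=
    (mem_cellOf hc').2 ⟨heΔ', hedges ▸ Set.inter_subset_right⟩
  have hcf : cellOf (midpoint ℝ e e') = cellOf f := by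
    by_contra hcf
    have hlt := finrank_vectorSpan_cellOf_lt hf hc hcf
    have heq : cellOf e = cellOf (midpoint ℝ e e') := by
      by_contra h
      have := finrank_vectorSpan_cellOf_lt hc' hec h
      omega
    have heq' : cellOf e' = cellOf (midpoint ℝ e e') := by
      by_contra h
      have := finrank_vectorSpan_cellOf_lt hc' hec' h
      omega
    exact hne (heq.trans heq'.symm)
  refine Set.Subset.antisymm ?_ (Set.subset_inter hfe hfe')
  rw [← hedges]
  exact ((mem_cellOf hc').1 (hcf ▸ self_mem_cellOf hf)).2

theorem exists_edges_eq_iInter (hsplit : TotallySplitDecomposable X) {e : Fin 3 → X → ℝ}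
    (he : ∀ j, e j ∈ hull' X)
    (hpair : ∀ i j x, ∃ y, e i x + e i y = dist x y ∧ e j x + e j y = dist x y) :
    ∃ h ∈ hull' X, h ∈ convexHull ℝ (Set.range e) ∧ edges h = ⋂ j, edges (e j) := by
  have hmem : ∀ j, e j ∈ convexHull ℝ (Set.range e) := fun j => subset_convexHull ℝ _ ⟨j, rfl⟩
  have hmid : midpoint ℝ (e 0) (e 1) ∈ Delta X := convex_Delta.midpoint_mem (he 0).1 (he 1).1
  have hedges : edges (midpoint ℝ (midpoint ℝ (e 0) (e 1)) (e 2)) = ⋂ j, edges (e j) := by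
    rw [edges_midpoint hmid (he 2).1, edges_midpoint (he 0).1 (he 1).1]
    ext
    simp [Fin.forall_fin_succ, and_assoc]
  refine ⟨midpoint ℝ (midpoint ℝ (e 0) (e 1)) (e 2),
    ⟨convex_Delta.midpoint_mem hmid (he 2).1, fun x => ?_⟩,
    (convex_convexHull ℝ _).midpoint_mem
      ((convex_convexHull ℝ _).midpoint_mem (hmem 0) (hmem 1)) (hmem 2), hedges⟩
  obtain ⟨y, h0, h1, h2⟩ := exists_common_edge hsplit (he 0) (he 1) (he 2)
    (hpair 0 1 x) (hpair 0 2 x) (hpair 1 2 x)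
  refine ⟨s(x, y), ?_, Sym2.mem_mk_left x y⟩
  simp [hedges, Fin.forall_fin_succ, mk_mem_edges, h0, h1, h2]

theorem exists_mem_convexHull_of_corner (hsplit : TotallySplitDecomposable X)
    {e f : Fin 3 → X → ℝ} [∀ i, FiniteDimensional ℝ (vectorSpan ℝ (cellOf (f i)))]
    (hf : ∀ i, f i ∈ hull' X) (hef : ∀ i j, i ≠ j → e j ∈ cellOf (f i)) {m : ℕ}
    (he : ∀ j, finrank ℝ (vectorSpan ℝ (cellOf (e j))) = m)
    (hfm : ∀ i, finrank ℝ (vectorSpan ℝ (cellOf (f i))) ≤ m + 1)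
    (hne : Function.Injective fun j => cellOf (e j)) :
    ∃ h ∈ hull' X, h ∈ convexHull ℝ (Set.range e) ∧ ∀ i, f i ∈ cellOf h := by
  have hedges : ∀ i j, i ≠ j → edges (f i) ⊆ edges (e j) := fun i j hij =>
    ((mem_cellOf (hf i)).1 (hef i j hij)).2
  have he' : ∀ j, e j ∈ hull' X := fun j =>
    mem_hull'_of_mem_cellOf (hf (j + 1)) (hef _ _ (by simp))
  obtain ⟨h, hh, hconv, hinter⟩ := exists_edges_eq_iInter hsplit he' fun i j x => by
    obtain ⟨l, hli, hlj⟩ : ∃ l, l ≠ i ∧ l ≠ j := by decide +revert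
    obtain ⟨y, hy⟩ := exists_edge (hf l) x
    exact ⟨y, edges_subset_edges.1 (hedges l i hli) x y hy,
      edges_subset_edges.1 (hedges l j hlj) x y hy⟩
  refine ⟨h, hh, hconv, fun i => (mem_cellOf hh).2 ⟨(hf i).1, ?_⟩⟩
  obtain ⟨j, l, hij, hil, hjl⟩ : ∃ j l, i ≠ j ∧ i ≠ l ∧ j ≠ l := by decide +revert
  rw [hinter, ← edges_inter_of_facets (hf i) (hef i j hij) (hef i l hil) (he j) (he l) (hfm i)
    (hne.ne hjl)]
  exact Set.subset_inter (Set.iInter_subset _ j) (Set.iInter_subset _ l)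

/-- The face spanned by the cells of the `e j` contains the relative interior point `h`, so it is
the whole cell of `h`. -/
theorem finrank_vectorSpan_cellOf_le_of_mem_convexHull (hint : IntegerValued X) {κ : Type*}
    [Fintype κ] {g h : X → ℝ} {e : κ → X → ℝ} (hh : h ∈ hull' X)
    (hcube : IsCombinatorialHypercube (cellOf h)) (heh : ∀ j, e j ∈ cellOf h)
    (hge : ∀ j, g ∈ cellOf (e j)) (hconv : h ∈ convexHull ℝ (Set.range e))
    (hdim : ∀ j, finrank ℝ (vectorSpan ℝ (cellOf (e j))) ≤
      finrank ℝ (vectorSpan ℝ (cellOf g)) + 1) :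
    finrank ℝ (vectorSpan ℝ (cellOf h)) ≤
      finrank ℝ (vectorSpan ℝ (cellOf g)) + Fintype.card κ := by
  have := IsPolytope.finiteDimensional hcube.1
  have he : ∀ j, e j ∈ hull' X := fun j => mem_hull'_of_mem_cellOf hh (heh j)
  obtain ⟨_, j, rfl⟩ := convexHull_nonempty_iff.1 ⟨h, hconv⟩
  have hg : g ∈ hull' X := mem_hull'_of_mem_cellOf (he j) (hge j)
  have hgh : g ∈ cellOf h := (isExtreme_cellOf hh (heh j)).subset (hge j)
  obtain ⟨Q, hQ, hQdim⟩ := hcube.exists_face_ge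
    (C := ⟨cellOf g, convex_cellOf hg, isExtreme_cellOf hh hgh⟩) ⟨g, self_mem_cellOf hg⟩
    (F := fun j => ⟨cellOf (e j), convex_cellOf (he j), isExtreme_cellOf hh (heh j)⟩)
    (fun j => (isExtreme_cellOf (he j) (hge j)).subset) hdim
  have hhQ : h ∈ Q.1 := convexHull_min
    (Set.range_subset_iff.2 fun j => hQ j (self_mem_cellOf (he j))) Q.2.1 hconv
  rwa [eq_cellOf_of_isExtreme hint hh Q.2.2 hhQ] at hQdim

theorem exists_cellOf_superset_of_corner (hint : IntegerValued X)
    (hsplit : TotallySplitDecomposable X)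
    (hcube : ∀ C ∈ cells X, IsCombinatorialHypercube C) {k : ℕ} {g : X → ℝ} {e f : Fin 3 → X → ℝ}
    (hf : ∀ i, f i ∈ hull' X) (hef : ∀ i j, i ≠ j → e j ∈ cellOf (f i))
    (hge : ∀ j, g ∈ cellOf (e j)) (hgk : finrank ℝ (vectorSpan ℝ (cellOf g)) = k)
    (hek : ∀ j, finrank ℝ (vectorSpan ℝ (cellOf (e j))) = k + 1)
    (hfk : ∀ i, finrank ℝ (vectorSpan ℝ (cellOf (f i))) = k + 2)
    (he : Function.Injective fun j => cellOf (e j)) (hf01 : ¬ cellOf (f 1) ⊆ cellOf (f 0)) :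
    ∃ h ∈ hull' X, finrank ℝ (vectorSpan ℝ (cellOf h)) = k + 3 ∧
      ∀ i, cellOf (f i) ⊆ cellOf h := by
  have hfin : ∀ {f}, f ∈ hull' X → FiniteDimensional ℝ (vectorSpan ℝ (cellOf f)) := fun hf =>
    IsPolytope.finiteDimensional (hcube _ (cellOf_mem_cells hf)).1
  have := fun i => hfin (hf i)
  obtain ⟨h, hh, hconv, hfh⟩ := exists_mem_convexHull_of_corner hsplit hf hef hek
    (fun i => (hfk i).le) he
  have := hfin hh
  have hsub : ∀ i, cellOf (f i) ⊆ cellOf h := fun i => (isExtreme_cellOf hh (hfh i)).subset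
  have hle := finrank_vectorSpan_cellOf_le_of_mem_convexHull hint hh
    (hcube _ (cellOf_mem_cells hh)) (fun j => hsub (j + 1) (hef _ _ (by simp))) hge hconv
    fun j => by rw [hek, hgk]
  have hlt := finrank_vectorSpan_cellOf_lt hh (hfh 0) fun heq => hf01 (heq ▸ hsub 1)
  rw [hfk] at hlt
  rw [hgk, Fintype.card_fin] at hle
  exact ⟨h, hh, by omega, hsub⟩

theorem cellDim_eq_natCast_iff_of_mem_cells (hcube : ∀ C ∈ cells X, IsCombinatorialHypercube C)
    {C : Set (X → ℝ)} (hC : C ∈ cells X) {n : ℕ} :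
    cellDim C = n ↔ finrank ℝ (vectorSpan ℝ C) = n :=
  have := IsPolytope.finiteDimensional (hcube C hC).1
  cellDim_eq_natCast_iff

theorem iInter_ne_eq_iInter {ι α : Type*} {A : ι → Set α} {i j : ι} (hij : i ≠ j)
    (h : ⋂ l, ⋂ (_ : l ≠ i), A l = ⋂ l, ⋂ (_ : l ≠ j), A l) :
    ⋂ l, ⋂ (_ : l ≠ i), A l = ⋂ l, A l := by
  refine subset_antisymm (Set.subset_iInter fun l => ?_)
    (Set.subset_iInter₂ fun l _ => Set.iInter_subset A l)
  rcases eq_or_ne l i with rfl | hl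
  · exact h ▸ Set.iInter₂_subset l hij
  · exact Set.iInter₂_subset l hl

end LinkCondition

end InjHull

open InjHull in
theorem theorem4p2_general {X : Type*} [PseudoMetricSpace X]
    (hint : IntegerValued X) (hsplit : TotallySplitDecomposable X)
    (hcube : ∀ C ∈ cells X, IsCombinatorialHypercube C) :
    CAT0LinkCondition (cells X) := by
  intro k C C₁ C₂ hC hC₁ hC₂ hCeq hC₁eq hCk hC₁k hC₂k
  simp only [cellDim_eq_natCast_iff_of_mem_cells hcube, hC, hC₁, hC₂] at hCk hC₁k hC₂k
  have hinj : Function.Injective C₁ := fun i j heq => by_contra fun hij => by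
    have hC₁C := iInter_ne_eq_iInter hij (by rw [← hC₁eq, ← hC₁eq, heq])
    rw [← hC₁eq, ← hCeq] at hC₁C
    exact Nat.succ_ne_self k ((hC₁k i).symm.trans (hC₁C ▸ hCk))
  have hnot : ¬ C₂ 1 ⊆ C₂ 0 := fun h01 => by
    have hC₁C₂ : C₁ 2 = C₂ 0 ∩ C₂ 1 := by ext; simp [hC₁eq, Fin.forall_fin_succ]
    rw [Set.inter_eq_right.2 h01] at hC₁C₂
    exact Nat.succ_ne_self (k + 1) ((hC₂k 1).symm.trans (hC₁C₂ ▸ hC₁k 2))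
  have hsub₁ : ∀ j, C ⊆ C₁ j := fun j => by
    rw [hC₁eq, hCeq]
    exact Set.subset_iInter₂ fun i _ => Set.iInter_subset _ i
  have hsub₂ : ∀ i j, i ≠ j → C₁ j ⊆ C₂ i := fun i j hij => hC₁eq j ▸ Set.iInter₂_subset i hij
  obtain ⟨g, hg, rfl⟩ : ∃ g ∈ hull' X, C = cellOf g := hC
  choose e he heC using (hC₁ : ∀ j, ∃ e ∈ hull' X, C₁ j = cellOf e)
  choose f hf hfC using (hC₂ : ∀ i, ∃ f ∈ hull' X, C₂ i = cellOf f)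
  obtain rfl : C₁ = fun j => cellOf (e j) := funext heC
  obtain rfl : C₂ = fun i => cellOf (f i) := funext hfC
  obtain ⟨h, hh, hhk, hfh⟩ := exists_cellOf_superset_of_corner hint hsplit hcube hf
    (fun i j hij => hsub₂ i j hij (self_mem_cellOf (he j))) (fun j => hsub₁ j (self_mem_cellOf hg))
    hCk hC₁k hC₂k hinj hnot
  exact ⟨cellOf h, cellOf_mem_cells hh,
    (cellDim_eq_natCast_iff_of_mem_cells hcube (cellOf_mem_cells hh)).2 hhk, Set.iUnion_subset hfh⟩

theorem theorem4p2 (X : Type*) [MetricSpace X]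
    (hint : InjHull.IntegerValued X)
    (hsplit : InjHull.TotallySplitDecomposable X)
    (hlrc : InjHull.LocalRankCondition X)
    (hcube : ∀ C ∈ InjHull.cells X, InjHull.IsCombinatorialHypercube C) :
    InjHull.CAT0LinkCondition (InjHull.cells X) :=
  theorem4p2_general hint hsplit hcube
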